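/- Work in $\mathbb{R}^n$ with the Euclidean inner product and norm $\|\cdot\|$. For $h:\mathbb{R}^n\to\overline{\mathbb{R}}$ and $z\in\mathbb{R}^n$ let $\partial h(z)=\{u: h(z+t)\ge h(z)+\langle u,t\rangle\ \forall t\in\mathbb{R}^n\}$ be the subdifferential, $D(h,z)=\{d:\exists a>0,\ h(z+ad)\le h(z)\}$ the descent cone, and $N(h,z)=\{u:\langle u,d\rangle\le 0\ \forall d\in D(h,z)\}$ the normal cone. Let $I$ be the indicator function of the non-negative orthant $\mathbb{R}^n_+$ (equal to $0$ on $\mathbb{R}^n_+$ and to $\infty$ elsewhere). For a set $S$ let $\operatorname{cone}(S)=\bigcup_{\tau\ge 0}\tau S$, and let $\operatorname{ri}(S)$ denote its relative interior. Let $g$ be a standard Gaussian vector in $\mathbb{R}^n$ (independent standard normal coordinates), and for a convex cone $K$ let $$\delta(K)=\mathbb{E}\Big(\sup_{t\in K,\ \|t\|\le 1}\langle g,t\rangle\Big)^2$$ be its statistical dimension. Let $f_0$ be a norm on $\mathbb{R}^n$ (not necessarily the Euclidean one) and let $x^\star\in\mathbb{R}^n$. Put $N=N(I,x^\star)$ and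 let $$C_3=\{u\in\mathbb{R}^n:\ \exists t>0,\ f_0(x^\star+tu)\le f_0(x^\star)\ \text{and}\ I(x^\star+tu)\le I(x^\star)\},$$ which for $x^\star\in\mathbb{R}^n_+$ is the prior restricted cone of the problem $\min f_0(x)$ subject to $y=Ax$, $x\ge 0$, with true signal $x^\star$. Assume that 1. $\partial f_0(x^\star)$ is non-empty, compact and does not contain the origin; 2. $\operatorname{ri}(D(f_0,x^\star))\cap\operatorname{ri}(D(I,x^\star))\ne\emptyset$; 3. $N+\partial f_0(x^\star)$ does not contain the origin; 4. $N+\operatorname{cone}(\partial f_0(x^\star))$ is closed. For $\tau\ge 0$ define $J_3(\tau)=\mathbb{E}\,\operatorname{dist}^2\big(g,\ N+\tau\,\partial f_0(x^\star)\big)$, where $\operatorname{dist}$ is the Euclidean distance. Then $$0\ \le\ \inf_{\tau\ge 0}J_3(\tau)-\delta(C_3)\ \le\ \frac{2\sup\{\|s\|: s\in\partial f_0(x^\star)\}}{f_0(x^\star/\|x^\star\|)}.$$ -/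

import Mathlib

open Set MeasureTheory ProbabilityTheory
open scoped Pointwise InnerProductSpace

noncomputable section

/-- The indicator function of `C` in the sense of convex analysis: `0` on `C`, `∞` off `C`. -/
def convexIndicator {n : ℕ} (C : Set (EuclideanSpace ℝ (Fin n))) :
    EuclideanSpace ℝ (Fin n) → EReal :=
  open Classical in fun x => if x ∈ C then 0 else ⊤

/-- The non-negative orthant of `ℝⁿ`. -/
def nonnegOrthant (n : ℕ) : Set (EuclideanSpace ℝ (Fin n)) := {x | ∀ i, 0 ≤ x i}

/-- The subdifferential `∂h(z)` of an extended-real-valued function. -/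
def subdifferential {n : ℕ} (h : EuclideanSpace ℝ (Fin n) → EReal)
    (z : EuclideanSpace ℝ (Fin n)) : Set (EuclideanSpace ℝ (Fin n)) :=
  {u | ∀ t, h z + ((⟪u, t⟫_ℝ : ℝ) : EReal) ≤ h (z + t)}

/-- The descent cone `D(h, z)`: the non-ascent directions of `h` at `z`. -/
def descentCone {n : ℕ} (h : EuclideanSpace ℝ (Fin n) → EReal)
    (z : EuclideanSpace ℝ (Fin n)) : Set (EuclideanSpace ℝ (Fin n)) :=
  {d | ∃ a : ℝ, 0 < a ∧ h (z + a • d) ≤ h z}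

/-- The polar cone `K° = {u | ⟨u, d⟩ ≤ 0 for all d ∈ K}`. -/
def polarCone {n : ℕ} (K : Set (EuclideanSpace ℝ (Fin n))) :
    Set (EuclideanSpace ℝ (Fin n)) :=
  {u | ∀ d ∈ K, ⟪u, d⟫_ℝ ≤ 0}

/-- The normal cone `N(h, z)`: the polar of the descent cone. -/
def normalCone {n : ℕ} (h : EuclideanSpace ℝ (Fin n) → EReal)
    (z : EuclideanSpace ℝ (Fin n)) : Set (EuclideanSpace ℝ (Fin n)) :=
  polarCone (descentCone h z)

/-- The cone generated by a set: `cone(S) = ⋃_{τ ≥ 0} τ • S`. -/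
def coneOf {n : ℕ} (S : Set (EuclideanSpace ℝ (Fin n))) : Set (EuclideanSpace ℝ (Fin n)) :=
  {u | ∃ τ : ℝ, 0 ≤ τ ∧ u ∈ τ • S}

/-- The prior restricted set of the problem `min f₀(x)` subject to `y = A x` and
`fᵢ(x) ≤ fᵢ(z)`, with true signal `z`; the family `f` comprises objective and constraints. -/
def priorRestrictedSet {n : ℕ} {ι : Type*} (f : ι → EuclideanSpace ℝ (Fin n) → EReal)
    (z : EuclideanSpace ℝ (Fin n)) : Set (EuclideanSpace ℝ (Fin n)) :=
  {d | ∀ i, f i (z + d) ≤ f i z}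

/-- The prior restricted cone: the directions `u` with `t • u` in the prior restricted set for
some `t > 0`. -/
def priorRestrictedCone {n : ℕ} {ι : Type*} (f : ι → EuclideanSpace ℝ (Fin n) → EReal)
    (z : EuclideanSpace ℝ (Fin n)) : Set (EuclideanSpace ℝ (Fin n)) :=
  {u | ∃ t : ℝ, 0 < t ∧ t • u ∈ priorRestrictedSet f z}

/-- The statistical dimension `δ(K) = 𝔼 (sup_{t ∈ K ∩ Bⁿ} ⟨g, t⟩)²`, `g ∼ N(0, Iₙ)`. -/
def statDim {n : ℕ} (K : Set (EuclideanSpace ℝ (Fin n))) : ℝ :=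
  ∫ g, (⨆ t : ↥(K ∩ Metric.closedBall 0 1), ⟪g, (t : EuclideanSpace ℝ (Fin n))⟫_ℝ) ^ 2
    ∂(stdGaussian (EuclideanSpace ℝ (Fin n)))

/-- The expected squared distance `𝔼 dist²(g, S)`, `g ∼ N(0, Iₙ)`. -/
def expDistSq {n : ℕ} (S : Set (EuclideanSpace ℝ (Fin n))) : ℝ :=
  ∫ g, Metric.infDist g S ^ 2 ∂(stdGaussian (EuclideanSpace ℝ (Fin n)))

/-- The prior restricted cone of the problem with non-negativity constraint,
`min f₀(x)` subject to `y = A x`, `x ≥ 0`. -/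
def nonnegRestrictedCone {n : ℕ} (f₀ : EuclideanSpace ℝ (Fin n) → EReal)
    (z : EuclideanSpace ℝ (Fin n)) : Set (EuclideanSpace ℝ (Fin n)) :=
  priorRestrictedCone ![f₀, convexIndicator (nonnegOrthant n)] z

/-- The function `J₃(τ) = 𝔼 dist²(g, N + τ • ∂f₀(z))`, where `N` is the normal cone at `z` of the
indicator function of the non-negative orthant. -/
def J₃ {n : ℕ} (f₀ : EuclideanSpace ℝ (Fin n) → EReal)
    (z : EuclideanSpace ℝ (Fin n)) (τ : ℝ) : ℝ :=
  expDistSq (normalCone (convexIndicator (nonnegOrthant n)) z + τ • subdifferential f₀ z)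

/-- The integrand of `expDistSq` is integrable. -/
theorem integrable_infDist_sq {n : ℕ} (S : Set (EuclideanSpace ℝ (Fin n))) :
    Integrable (fun g => Metric.infDist g S ^ 2) (stdGaussian (EuclideanSpace ℝ (Fin n))) := by
  rcases S.eq_empty_or_nonempty with rfl | ⟨s, hs⟩
  · simp
  have h : MemLp (fun g : EuclideanSpace ℝ (Fin n) => g - s) 2 (stdGaussian (EuclideanSpace ℝ (Fin n))) :=
    IsGaussian.memLp_two_id.sub (memLp_const s)
  refine (h.mono (Metric.continuous_infDist_pt S).aestronglyMeasurable ?_).integrable_sq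
  refine Filter.Eventually.of_forall fun g => ?_
  rw [Real.norm_of_nonneg Metric.infDist_nonneg, ← dist_eq_norm]
  exact Metric.infDist_le_dist_of_mem hs

/-- The integrand of `statDim` is integrable. -/
theorem integrable_sup_sq {n : ℕ} (K : Set (EuclideanSpace ℝ (Fin n))) :
    Integrable (fun g => (⨆ t : ↥(K ∩ Metric.closedBall 0 1), ⟪g, (t : EuclideanSpace ℝ (Fin n))⟫_ℝ) ^ 2)
      (stdGaussian (EuclideanSpace ℝ (Fin n))) := by
  rcases isEmpty_or_nonempty ↥(K ∩ Metric.closedBall (0:EuclideanSpace ℝ (Fin n)) 1) with h | h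
  · simp
  have key : ∀ g : EuclideanSpace ℝ (Fin n), ∀ t : ↥(K ∩ Metric.closedBall (0:EuclideanSpace ℝ (Fin n)) 1), |⟪g, (t : EuclideanSpace ℝ (Fin n))⟫_ℝ| ≤ ‖g‖ := fun g t => by
    have := t.2.2
    rw [mem_closedBall_zero_iff] at this
    exact (abs_real_inner_le_norm _ _).trans (mul_le_of_le_one_right (norm_nonneg _) this)
  have bdd : ∀ g : EuclideanSpace ℝ (Fin n), BddAbove (range fun t : ↥(K ∩ Metric.closedBall (0:EuclideanSpace ℝ (Fin n)) 1) => ⟪g, (t : EuclideanSpace ℝ (Fin n))⟫_ℝ) :=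
    fun g => ⟨‖g‖, by rintro _ ⟨t, rfl⟩; exact (le_abs_self _).trans (key g t)⟩
  have lip : LipschitzWith 1 (fun g : EuclideanSpace ℝ (Fin n) => ⨆ t : ↥(K ∩ Metric.closedBall 0 1), ⟪g, (t : EuclideanSpace ℝ (Fin n))⟫_ℝ) := by
    refine LipschitzWith.of_le_add fun g g' => ciSup_le fun t => ?_
    have h1 := le_ciSup (bdd g') t
    have h2 := (le_abs_self _).trans (key (g - g') t)
    rw [inner_sub_left, ← dist_eq_norm] at h2
    linarith
  have hm : MemLp (fun g : EuclideanSpace ℝ (Fin n) => g) 2 (stdGaussian (EuclideanSpace ℝ (Fin n))) := IsGaussian.memLp_two_id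
  refine (hm.mono lip.continuous.aestronglyMeasurable ?_).integrable_sq
  refine Filter.Eventually.of_forall fun g => ?_
  have t0 := Classical.arbitrary ↥(K ∩ Metric.closedBall (0:EuclideanSpace ℝ (Fin n)) 1)
  rw [Real.norm_eq_abs, abs_le]
  exact ⟨(neg_le_of_abs_le (key g t0)).trans (le_ciSup (bdd g) t0),
    ciSup_le fun t => (le_abs_self _).trans (key g t)⟩

end

/-! Write `x` for the signal, `S = ∂f₀(x)`, `C` for the restricted cone and `K = N + cone(S)`.
Duality gives `N + τS ⊆ C°`, hence the lower bound. It also gives `K° ⊆ closure C`, so the expected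
squared distance to `K` is at most `δ(C)`. It remains to find one `τ₀` for which `N + τ₀S` is nearly
as good as `K`.

The projection of `g` onto `K` is `ν + τ(g)s`. Pairing with `x` kills `N` and is constantly `f₀(x)`
on `S`, so `τ(g)` is a Lipschitz function of `g` with constant `‖x‖/f₀(x)`. Put `τ₀ = 𝔼τ(g)`, let
`Q` be the projection onto `N + τ₀S`, and let `σ(g)` be the support function of `S` at `g - Qg`,
which is Lipschitz with constant `R = sup ‖s‖`. Expanding squares gives `dist²(g, N + τ₀S) ≤
dist²(g, K) + 2(τ(g) - τ₀)σ(g)`. The mean of the last term is twice the covariance of `τ` and `σ`,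
which the Gaussian covariance inequality `integral_mul_sub_le_of_lipschitzWith` bounds by the
product of the two Lipschitz constants. The comparison is `exists_expDistSq_add_smul_le`. -/

/-! ### Absolute continuity of the Gaussian measure. -/

/-- Products of absolutely continuous measures over `Fin n` are absolutely continuous. -/
theorem pi_absolutelyContinuous_pi {n : ℕ} {μ ν : Measure ℝ} [SigmaFinite μ] [SigmaFinite ν]
    (h : μ ≪ ν) :
    Measure.pi (fun _ : Fin n => μ) ≪ Measure.pi (fun _ : Fin n => ν) := by
  induction n with
  | zero => rw [Measure.pi_of_empty, Measure.pi_of_empty]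
  | succ n ih =>
    have h1 := (measurePreserving_piFinSuccAbove (fun _ : Fin (n + 1) => μ) 0).symm
    have h2 := (measurePreserving_piFinSuccAbove (fun _ : Fin (n + 1) => ν) 0).symm
    rw [← h1.map_eq, ← h2.map_eq]
    exact (h.prod ih).map h1.measurable

/-- Transfers Rademacher's theorem, a Lebesgue-a.e. statement, to the Gaussian measure. -/
theorem stdGaussian_absolutelyContinuous (n : ℕ) :
    stdGaussian (EuclideanSpace ℝ (Fin n)) ≪ volume := by
  rw [← map_pi_eq_stdGaussian, ← (PiLp.volume_preserving_toLp (Fin n)).map_eq]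
  exact (pi_absolutelyContinuous_pi
    (gaussianReal_absolutelyContinuous 0 one_ne_zero)).map (by fun_prop)

/-! ### Gaussian integration by parts for Lipschitz functions, by reflection. -/

section Poincare

variable {E : Type*} [NormedAddCommGroup E] [InnerProductSpace ℝ E] [FiniteDimensional ℝ E]
  [MeasurableSpace E] [BorelSpace E]

theorem memLp_two_of_lipschitzWith {μ : Measure E} [IsGaussian μ] {C : NNReal} {H : E → ℝ}
    (hH : LipschitzWith C H) : MemLp H 2 μ := by
  have hn : MemLp (fun w : E => ‖w‖) 2 μ := IsGaussian.memLp_two_id.norm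
  have h : MemLp (fun w : E => |H 0| + C * ‖w‖) 2 μ :=
    MemLp.add (memLp_const |H 0|) (hn.const_mul (C : ℝ))
  refine h.mono hH.continuous.aestronglyMeasurable (Filter.Eventually.of_forall fun w => ?_)
  have h1 := hH.dist_le_mul w 0
  rw [dist_zero_right, Real.dist_eq] at h1
  rw [Real.norm_eq_abs, Real.norm_of_nonneg (by positivity)]
  linarith [abs_sub_abs_le_abs_sub (H w) (H 0)]

theorem integral_inner_sq_stdGaussian (v : E) :
    ∫ w, ⟪v, w⟫_ℝ ^ 2 ∂(stdGaussian E) = ‖v‖ ^ 2 := by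
  have h := variance_dual_stdGaussian (innerSL ℝ v)
  rw [variance_of_integral_eq_zero (by fun_prop) (integral_strongDual_stdGaussian _),
    innerSL_apply_norm] at h
  simpa using h

/-- First-order Gaussian integration by parts, as an estimate for Lipschitz functions. -/
theorem abs_integral_mul_inner_stdGaussian_le {C : NNReal} {H : E → ℝ} (hH : LipschitzWith C H)
    (v : E) : |∫ w, H w * ⟪v, w⟫_ℝ ∂(stdGaussian E)| ≤ C * ‖v‖ := by
  rcases eq_or_ne v 0 with rfl | hv
  · simp
  -- Reflection in the hyperplane orthogonal to `v` preserves the Gaussian and flips the sign of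
  -- `⟪v, w⟫`. The integral is therefore half that of `(H w - H (R w)) * ⟪v, w⟫`, and `‖w - R w‖ = 2
  -- |⟪v, w⟫| / ‖v‖`. No derivative of `H` is needed.
  set R := (ℝ ∙ v)ᗮ.reflection with hR
  have hRw : ∀ w, R w = w - (2 * (⟪v, w⟫_ℝ / ‖v‖ ^ 2)) • v := fun w => by
    rw [hR, Submodule.reflection_orthogonal_apply, Submodule.reflection_singleton_apply]
    simp only [two_smul, two_mul, add_smul, RCLike.ofReal_real_eq_id, id_eq]
    abel
  have hv2 : ‖v‖ ^ 2 ≠ 0 := by positivity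
  have hin : ∀ w, ⟪v, R w⟫_ℝ = -⟪v, w⟫_ℝ := fun w => by
    rw [hRw, inner_sub_right, inner_smul_right, real_inner_self_eq_norm_sq]
    field_simp; ring
  have hinv : ∫ w, H w * ⟪v, w⟫_ℝ ∂(stdGaussian E) = -∫ w, H (R w) * ⟪v, w⟫_ℝ ∂(stdGaussian E) := by
    have h := stdGaussian_map R
    conv_lhs => rw [← h]
    have hc : Continuous fun w => H w * ⟪v, w⟫_ℝ := hH.continuous.mul (by fun_prop)
    rw [integral_map R.continuous.measurable.aemeasurable hc.aestronglyMeasurable,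
      ← integral_neg]
    simp [hin]
  have hin2 : MemLp (fun w => ⟪v, w⟫_ℝ) 2 (stdGaussian E) :=
    IsGaussian.memLp_two_id.const_inner v
  have hHR : LipschitzWith C (fun w => H (R w)) := by
    simpa using! hH.comp R.lipschitz
  have i1 : Integrable (fun w => H w * ⟪v, w⟫_ℝ) (stdGaussian E) :=
    (memLp_two_of_lipschitzWith hH).integrable_mul hin2
  have i2 : Integrable (fun w => H (R w) * ⟪v, w⟫_ℝ) (stdGaussian E) :=
    (memLp_two_of_lipschitzWith hHR).integrable_mul hin2
  have key : 2 * ∫ w, H w * ⟪v, w⟫_ℝ ∂(stdGaussian E)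
      = ∫ w, (H w - H (R w)) * ⟪v, w⟫_ℝ ∂(stdGaussian E) := by
    simp_rw [sub_mul]
    rw [integral_sub i1 i2]
    linarith
  have hb : |∫ w, (H w - H (R w)) * ⟪v, w⟫_ℝ ∂(stdGaussian E)|
      ≤ ∫ w, (2 * C / ‖v‖) * ⟪v, w⟫_ℝ ^ 2 ∂(stdGaussian E) := by
    rw [← Real.norm_eq_abs]
    refine norm_integral_le_of_norm_le (hin2.integrable_sq.const_mul _)
      (Filter.Eventually.of_forall fun w => ?_)
    have h1 := hH.dist_le_mul w (R w)
    rw [dist_eq_norm, dist_eq_norm, hRw, sub_sub_cancel, norm_smul, Real.norm_eq_abs,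
      Real.norm_eq_abs, abs_mul, abs_div, abs_of_pos (show (0:ℝ) < 2 by norm_num),
      abs_of_nonneg (sq_nonneg ‖v‖)] at h1
    rw [norm_mul, Real.norm_eq_abs, Real.norm_eq_abs, hRw]
    calc _ ≤ (C * (2 * (|⟪v, w⟫_ℝ| / ‖v‖ ^ 2) * ‖v‖)) * |⟪v, w⟫_ℝ| := by gcongr
      _ = (2 * C / ‖v‖) * |⟪v, w⟫_ℝ| ^ 2 := by
        have : ‖v‖ ≠ 0 := by positivity
        field_simp
      _ = _ := by rw [sq_abs]
  rw [integral_const_mul, integral_inner_sq_stdGaussian, ← key, abs_mul,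
    abs_of_pos (show (0:ℝ) < 2 by norm_num)] at hb
  have : 2 * C / ‖v‖ * ‖v‖ ^ 2 = 2 * (C * ‖v‖) := by
    have : ‖v‖ ≠ 0 := by positivity
    field_simp
  linarith

theorem abs_integral_mul_dual_stdGaussian_le {C : NNReal} {H : E → ℝ} (hH : LipschitzWith C H)
    (L : StrongDual ℝ E) : |∫ w, H w * L w ∂(stdGaussian E)| ≤ C * ‖L‖ := by
  have h := abs_integral_mul_inner_stdGaussian_le hH ((InnerProductSpace.toDual ℝ E).symm L)
  simpa using h

end Poincare

/-! ### The Gaussian covariance inequality, by rotating a pair of independent Gaussians. -/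

section Covariance

variable {n : ℕ}

local notation "𝓔" => EuclideanSpace ℝ (Fin n)

theorem ae_prod_differentiableAt {C : NNReal} {F : 𝓔 → ℝ} (hF : LipschitzWith C F) :
    ∀ᵐ z ∂((stdGaussian 𝓔).prod (stdGaussian 𝓔)), DifferentiableAt ℝ F z.1 :=
  Measure.quasiMeasurePreserving_fst.ae
    ((stdGaussian_absolutelyContinuous n).ae_le hF.ae_differentiableAt)

/-- The correlation of two Lipschitz functions along the Ornstein-Uhlenbeck interpolation. -/
noncomputable def gaussianInterp (G F : 𝓔 → ℝ) (θ : ℝ) : ℝ :=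
  ∫ z, G z.1 * F (Real.cos θ • z.1 + Real.sin θ • z.2) ∂((stdGaussian 𝓔).prod (stdGaussian 𝓔))

/-- Rotation invariance of the pair moves `θ` into the argument of `G`. At `h = 0` the function `F`
is then evaluated at `z.1`, so differentiating at any `θ` only needs `F` differentiable almost
everywhere. -/
theorem gaussianInterp_add {C D : NNReal} {G F : 𝓔 → ℝ} (hG : LipschitzWith D G)
    (hF : LipschitzWith C F) (θ h : ℝ) :
    gaussianInterp G F (θ + h) = ∫ z, G (Real.cos θ • z.1 - Real.sin θ • z.2) *
      F (Real.cos h • z.1 + Real.sin h • z.2) ∂((stdGaussian 𝓔).prod (stdGaussian 𝓔)) := by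
  have hrot := IsGaussian.map_rotation_eq_self (μ := stdGaussian 𝓔) (integral_id_stdGaussian) (-θ)
  have hFc := hF.continuous
  have hGc := hG.continuous
  rw [gaussianInterp]
  conv_lhs => rw [← hrot]
  rw [integral_map (by fun_prop) (by
    refine Continuous.aestronglyMeasurable ?_
    fun_prop)]
  simp only [ContinuousLinearMap.rotation_apply, Real.cos_neg, Real.sin_neg, neg_neg, neg_smul,
    ← sub_eq_add_neg]
  congr! 4 with z
  rw [Real.cos_add, Real.sin_add]
  have h1 := Real.sin_sq_add_cos_sq θ
  have e1 : Real.cos h = Real.cos h * (Real.sin θ ^ 2 + Real.cos θ ^ 2) := by rw [h1, mul_one]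
  have e2 : Real.sin h = Real.sin h * (Real.sin θ ^ 2 + Real.cos θ ^ 2) := by rw [h1, mul_one]
  conv_rhs => rw [e1, e2]
  module

theorem exists_hasDerivAt_gaussianInterp {C D : NNReal} {G F : 𝓔 → ℝ} (hG : LipschitzWith D G)
    (hF : LipschitzWith C F) (θ : ℝ) :
    ∃ d, HasDerivAt (gaussianInterp G F) d θ ∧ |d| ≤ |Real.sin θ| * (D * C) := by
  set μ := stdGaussian 𝓔 with hμ
  have hFc := hF.continuous
  have hGc := hG.continuous
  set u : 𝓔 × 𝓔 → ℝ := fun z => G (Real.cos θ • z.1 - Real.sin θ • z.2) with hu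
  have huc : Continuous u := by fun_prop
  have hn : MemLp (fun w : 𝓔 => ‖w‖) 2 μ := IsGaussian.memLp_two_id.norm
  have hm : MemLp (fun z : 𝓔 × 𝓔 => ‖z.1‖ + ‖z.2‖) 2 (μ.prod μ) :=
    MemLp.add (hn.comp_fst μ) (hn.comp_snd μ)
  have hcs : ∀ (a b : ℝ), |a| ≤ 1 → |b| ≤ 1 → ∀ z : 𝓔 × 𝓔,
      ‖a • z.1 + b • z.2‖ ≤ ‖z.1‖ + ‖z.2‖ := fun a b ha hb z => by
    refine (norm_add_le _ _).trans ?_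
    rw [norm_smul, norm_smul, Real.norm_eq_abs, Real.norm_eq_abs]
    exact add_le_add (mul_le_of_le_one_left (norm_nonneg _) ha)
      (mul_le_of_le_one_left (norm_nonneg _) hb)
  have hlip0 : ∀ {K : NNReal} {H : 𝓔 → ℝ}, LipschitzWith K H → ∀ w, |H w| ≤ |H 0| + K * ‖w‖ :=
    fun {K H} hH w => by
      have h1 := hH.dist_le_mul w 0
      rw [dist_zero_right, Real.dist_eq] at h1
      linarith [abs_sub_abs_le_abs_sub (H w) (H 0)]
  have hcomp : ∀ {K : NNReal} {H : 𝓔 → ℝ}, LipschitzWith K H → ∀ a b : ℝ, |a| ≤ 1 → |b| ≤ 1 →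
      MemLp (fun z : 𝓔 × 𝓔 => H (a • z.1 + b • z.2)) 2 (μ.prod μ) := fun {K H} hH a b ha hb => by
    have hHc := hH.continuous
    have h2 : MemLp (fun z : 𝓔 × 𝓔 => |H 0| + K * (‖z.1‖ + ‖z.2‖)) 2 (μ.prod μ) :=
      MemLp.add (memLp_const |H 0|) (hm.const_mul (K : ℝ))
    refine h2.mono (Continuous.aestronglyMeasurable (by fun_prop))
      (Filter.Eventually.of_forall fun z => ?_)
    rw [Real.norm_eq_abs, Real.norm_of_nonneg (by positivity)]
    refine (hlip0 hH _).trans ?_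
    gcongr
    exact hcs a b ha hb z
  have hu2 : MemLp u 2 (μ.prod μ) := by
    have := hcomp hG (Real.cos θ) (-Real.sin θ) (Real.abs_cos_le_one θ)
      (by rw [abs_neg]; exact Real.abs_sin_le_one θ)
    simpa only [neg_smul, ← sub_eq_add_neg] using this
  -- Differentiation under the integral at `h = 0`. Since `cos` and `sin` are 1-Lipschitz, `‖z.1‖ +
  -- ‖z.2‖` controls the increments of the moving point for all `h`.
  have hd := hasDerivAt_integral_of_dominated_loc_of_lip (μ := μ.prod μ) (x₀ := (0 : ℝ)) (s := univ)
    (F := fun h z => u z * F (Real.cos h • z.1 + Real.sin h • z.2))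
    (F' := fun z => u z * fderiv ℝ F z.1 z.2)
    (bound := fun z => |u z| * (C * (‖z.1‖ + ‖z.2‖)))
    Filter.univ_mem
    (Filter.Eventually.of_forall fun h => Continuous.aestronglyMeasurable (by fun_prop))
    (hu2.integrable_mul (hcomp hF _ _ (Real.abs_cos_le_one 0) (Real.abs_sin_le_one 0)))
    (by
      refine huc.aestronglyMeasurable.mul (Measurable.aestronglyMeasurable ?_)
      exact (isBoundedBilinearMap_apply (𝕜 := ℝ) (E := 𝓔) (F := ℝ)).continuous.measurable.comp
        (((measurable_fderiv ℝ F).comp measurable_fst).prodMk measurable_snd))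
    (Filter.Eventually.of_forall fun z => by
      refine LipschitzWith.lipschitzOnWith (LipschitzWith.of_dist_le_mul fun a b => ?_)
      rw [Real.coe_nnabs, abs_of_nonneg (by positivity), Real.dist_eq, ← mul_sub, abs_mul,
        mul_assoc]
      gcongr
      rw [← Real.dist_eq]
      refine (hF.dist_le_mul _ _).trans ?_
      rw [mul_assoc]
      gcongr
      rw [dist_eq_norm, show Real.cos a • z.1 + Real.sin a • z.2 -
        (Real.cos b • z.1 + Real.sin b • z.2)
        = (Real.cos a - Real.cos b) • z.1 + (Real.sin a - Real.sin b) • z.2 by module]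
      refine (norm_add_le _ _).trans ?_
      rw [norm_smul, norm_smul, Real.norm_eq_abs, Real.norm_eq_abs, add_mul, mul_comm ‖z.1‖,
        mul_comm ‖z.2‖]
      have h1 := Real.lipschitzWith_cos.dist_le_mul a b
      have h2 := Real.lipschitzWith_sin.dist_le_mul a b
      rw [NNReal.coe_one, one_mul, Real.dist_eq (Real.cos a)] at h1
      rw [NNReal.coe_one, one_mul, Real.dist_eq (Real.sin a)] at h2
      gcongr)
    (hu2.abs.integrable_mul (hm.const_mul _))
    (by
      filter_upwards [ae_prod_differentiableAt hF] with z hz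
      refine HasDerivAt.const_mul _ ?_
      have h1 : HasDerivAt (fun h : ℝ => Real.cos h • z.1 + Real.sin h • z.2) z.2 0 := by
        simpa using ((Real.hasDerivAt_cos 0).smul_const z.1).fun_add
          ((Real.hasDerivAt_sin 0).smul_const z.2)
      have h2 : HasFDerivAt F (fderiv ℝ F z.1) (Real.cos 0 • z.1 + Real.sin 0 • z.2) := by
        simpa using hz.hasFDerivAt
      exact h2.comp_hasDerivAt 0 h1)
  refine ⟨∫ z, u z * fderiv ℝ F z.1 z.2 ∂(μ.prod μ), ?_, ?_⟩
  · have h1 := hd.2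
    simp_rw [hu, hμ, ← gaussianInterp_add hG hF] at h1
    have h2 : HasDerivAt (fun t => gaussianInterp G F (θ + (t - θ)))
        (∫ z, u z * fderiv ℝ F z.1 z.2 ∂(μ.prod μ)) θ := by
      refine HasDerivAt.comp_sub_const (f := fun t => gaussianInterp G F (θ + t)) θ θ ?_
      rw [sub_self]
      exact h1
    simpa using h2
  -- With `z.1 = y` fixed, the inner integral pairs the linear form `fderiv ℝ F y` with a function
  -- of `z.2` of Lipschitz constant `D |sin θ|`, so the integration by parts estimate applies.
  · rw [integral_prod _ hd.1, ← Real.norm_eq_abs]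
    refine (norm_integral_le_of_norm_le_const (C := |Real.sin θ| * (D * C))
      (Filter.Eventually.of_forall fun y => ?_)).trans (by simp)
    have hl : LipschitzWith (D * Real.nnabs (Real.sin θ))
        (fun w : 𝓔 => G (Real.cos θ • y - Real.sin θ • w)) := by
      refine hG.comp (LipschitzWith.of_dist_le_mul fun a b => ?_)
      rw [dist_sub_left, dist_smul₀, Real.coe_nnabs, Real.norm_eq_abs]
    have h1 := abs_integral_mul_dual_stdGaussian_le hl (fderiv ℝ F y)
    rw [Real.norm_eq_abs]
    refine h1.trans ?_
    have h2 := norm_fderiv_le_of_lipschitz ℝ hF (x₀ := y)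
    rw [NNReal.coe_mul, Real.coe_nnabs]
    calc _ ≤ (D : ℝ) * |Real.sin θ| * C := by gcongr
      _ = _ := by ring

/-- **Gaussian covariance inequality** (Poincaré inequality) for Lipschitz functions. -/
theorem integral_mul_sub_le_of_lipschitzWith {C D : NNReal} {G F : 𝓔 → ℝ} (hG : LipschitzWith D G)
    (hF : LipschitzWith C F) :
    ∫ x, G x * F x ∂(stdGaussian 𝓔) - (∫ x, G x ∂(stdGaussian 𝓔)) * ∫ x, F x ∂(stdGaussian 𝓔)
      ≤ D * C := by
  choose d hd hb using exists_hasDerivAt_gaussianInterp hG hF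
  have h0 : gaussianInterp G F 0 = ∫ x, G x * F x ∂(stdGaussian 𝓔) := by
    simp only [gaussianInterp, Real.cos_zero, Real.sin_zero, one_smul, zero_smul, add_zero]
    rw [integral_fun_fst (fun x => G x * F x)]
    simp
  have h1 : gaussianInterp G F (Real.pi / 2)
      = (∫ x, G x ∂(stdGaussian 𝓔)) * ∫ x, F x ∂(stdGaussian 𝓔) := by
    simp only [gaussianInterp, Real.cos_pi_div_two, Real.sin_pi_div_two, one_smul, zero_smul,
      zero_add]
    exact integral_prod_mul G F
  have hpi := Real.pi_pos
  -- The derivative of the interpolation is at least `-sin θ * (D * C)`, and `sin` has integral 1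
  -- over `[0, π/2]`; this is the constant in the result.
  have hmono : MonotoneOn (fun θ => gaussianInterp G F θ - Real.cos θ * (D * C))
      (Icc 0 (Real.pi / 2)) := by
    have hder : ∀ θ, HasDerivAt (fun θ => gaussianInterp G F θ - Real.cos θ * (D * C))
        (d θ - -Real.sin θ * (D * C)) θ := fun θ =>
      (hd θ).sub ((Real.hasDerivAt_cos θ).mul_const _)
    refine monotoneOn_of_deriv_nonneg (convex_Icc _ _)
      (fun θ _ => (hder θ).continuousAt.continuousWithinAt)
      (fun θ _ => (hder θ).differentiableAt.differentiableWithinAt) fun θ hθ => ?_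
    rw [interior_Icc] at hθ
    rw [(hder θ).deriv]
    have hs : 0 ≤ Real.sin θ := Real.sin_nonneg_of_nonneg_of_le_pi hθ.1.le (by linarith [hθ.2])
    have h2 := (abs_le.1 (hb θ)).1
    rw [abs_of_nonneg hs] at h2
    linarith
  have h3 := hmono (left_mem_Icc.2 (by positivity)) (right_mem_Icc.2 (by positivity))
    (by positivity : (0:ℝ) ≤ Real.pi / 2)
  simp only [Real.cos_zero, Real.cos_pi_div_two, h0, h1] at h3
  linarith

end Covariance

/-! ### Projections onto closed convex sets. -/

section Projection

variable {E : Type*} [NormedAddCommGroup E] [InnerProductSpace ℝ E]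

theorem exists_forall_inner_sub_le_zero [CompleteSpace E] {K : Set E} (hne : K.Nonempty)
    (hc : IsClosed K) (hK : Convex ℝ K) (g : E) :
    ∃ u ∈ K, ∀ v ∈ K, ⟪g - u, v - u⟫_ℝ ≤ 0 := by
  obtain ⟨u, hu, h⟩ := exists_norm_eq_iInf_of_complete_convex hne hc.isComplete hK g
  exact ⟨u, hu, (norm_eq_iInf_iff_real_inner_le_zero hK hu).1 h⟩

/-- Firm nonexpansiveness. With the next two lemmas it makes both the projection and its residual
1-Lipschitz. -/
theorem inner_sub_sub_nonneg_of_proj {K : Set E} {g g' u u' : E} (hu : u ∈ K) (hu' : u' ∈ K)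
    (h : ∀ v ∈ K, ⟪g - u, v - u⟫_ℝ ≤ 0) (h' : ∀ v ∈ K, ⟪g' - u', v - u'⟫_ℝ ≤ 0) :
    0 ≤ ⟪(g - g') - (u - u'), u - u'⟫_ℝ := by
  have h1 := h u' hu'
  have h2 := h' u hu
  rw [← neg_sub u u', inner_neg_right] at h1
  have : (g - g') - (u - u') = (g - u) - (g' - u') := by abel
  rw [this, inner_sub_left]
  linarith

theorem norm_le_of_inner_sub_nonneg {a b : E} (h : 0 ≤ ⟪a - b, b⟫_ℝ) : ‖b‖ ≤ ‖a‖ := by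
  rw [inner_sub_left, real_inner_self_eq_norm_sq] at h
  nlinarith [real_inner_le_norm a b, norm_nonneg a, norm_nonneg b]

theorem norm_sub_le_of_inner_sub_nonneg {a b : E} (h : 0 ≤ ⟪a - b, b⟫_ℝ) : ‖a - b‖ ≤ ‖a‖ := by
  refine norm_le_of_inner_sub_nonneg ?_
  rwa [sub_sub_cancel, real_inner_comm]

theorem infDist_eq_norm_sub_of_proj {K : Set E} {g u : E} (hu : u ∈ K)
    (h : ∀ v ∈ K, ⟪g - u, v - u⟫_ℝ ≤ 0) : Metric.infDist g K = ‖g - u‖ := by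
  refine le_antisymm ((Metric.infDist_le_dist_of_mem hu).trans_eq (dist_eq_norm _ _)) ?_
  refine (Metric.le_infDist ⟨u, hu⟩).2 fun v hv => ?_
  rw [dist_eq_norm]
  have h1 := h v hv
  have h2 : g - v = (g - u) - (v - u) := by abel
  have h3 := norm_sub_sq_real (g - u) (v - u)
  rw [← h2] at h3
  nlinarith [norm_nonneg (g - v), norm_nonneg (g - u), sq_nonneg ‖v - u‖]

end Projection

/-! ### Cones, polarity, and the comparison of distances with statistical dimension. -/

section Cones

variable {n : ℕ}

local notation "𝓔" => EuclideanSpace ℝ (Fin n)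

theorem isClosed_polarCone (K : Set 𝓔) : IsClosed (polarCone K) := by
  have : polarCone K = ⋂ d ∈ K, {u : 𝓔 | ⟪u, d⟫_ℝ ≤ 0} := by
    ext u; simp [polarCone]
  rw [this]
  exact isClosed_biInter fun d _ => isClosed_le (by fun_prop) continuous_const

theorem zero_mem_polarCone (K : Set 𝓔) : (0 : 𝓔) ∈ polarCone K := fun d _ => by simp

theorem add_mem_polarCone {K : Set 𝓔} {u v : 𝓔} (hu : u ∈ polarCone K) (hv : v ∈ polarCone K) :
    u + v ∈ polarCone K := fun d hd => by
  rw [inner_add_left]; exact add_nonpos (hu d hd) (hv d hd)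

theorem smul_mem_polarCone {K : Set 𝓔} {u : 𝓔} {a : ℝ} (ha : 0 ≤ a) (hu : u ∈ polarCone K) :
    a • u ∈ polarCone K := fun d hd => by
  rw [real_inner_smul_left]; exact mul_nonpos_of_nonneg_of_nonpos ha (hu d hd)

theorem convex_polarCone (K : Set 𝓔) : Convex ℝ (polarCone K) := fun _ hu _ hv _ _ ha hb _ =>
  add_mem_polarCone (smul_mem_polarCone ha hu) (smul_mem_polarCone hb hv)

theorem convex_coneOf {S : Set 𝓔} (hS : Convex ℝ S) : Convex ℝ (coneOf S) := by
  rintro _ ⟨τ, hτ, hu⟩ _ ⟨τ', hτ', hv⟩ a b ha hb _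
  refine ⟨a * τ + b * τ', by positivity, ?_⟩
  rw [hS.add_smul (by positivity) (by positivity), mul_smul, mul_smul]
  exact add_mem_add (smul_mem_smul_set hu) (smul_mem_smul_set hv)

theorem smul_mem_coneOf {S : Set 𝓔} {u : 𝓔} {a : ℝ} (ha : 0 ≤ a) (hu : u ∈ coneOf S) :
    a • u ∈ coneOf S := by
  obtain ⟨τ, hτ, hu⟩ := hu
  refine ⟨a * τ, by positivity, ?_⟩
  rw [mul_smul]
  exact smul_mem_smul_set hu

theorem zero_mem_coneOf {S : Set 𝓔} (hS : S.Nonempty) : (0 : 𝓔) ∈ coneOf S := by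
  obtain ⟨s, hs⟩ := hS
  exact ⟨0, le_rfl, s, hs, by simp⟩

theorem bddAbove_inner_inter_closedBall (K : Set 𝓔) (g : 𝓔) :
    BddAbove (range fun t : ↥(K ∩ Metric.closedBall 0 1) => ⟪g, (t : 𝓔)⟫_ℝ) := by
  refine ⟨‖g‖, ?_⟩
  rintro _ ⟨t, rfl⟩
  have := t.2.2
  rw [mem_closedBall_zero_iff] at this
  exact (real_inner_le_norm _ _).trans (mul_le_of_le_one_right (norm_nonneg _) this)

theorem le_iSup_inner {K : Set 𝓔} {t : 𝓔} (ht : t ∈ K) (h1 : ‖t‖ ≤ 1) (g : 𝓔) :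
    ⟪g, t⟫_ℝ ≤ ⨆ t : ↥(K ∩ Metric.closedBall 0 1), ⟪g, (t : 𝓔)⟫_ℝ :=
  le_ciSup (bddAbove_inner_inter_closedBall K g) ⟨t, ht, mem_closedBall_zero_iff.2 h1⟩

theorem iSup_inner_nonneg {K : Set 𝓔} (h0 : (0 : 𝓔) ∈ K) (g : 𝓔) :
    0 ≤ ⨆ t : ↥(K ∩ Metric.closedBall 0 1), ⟪g, (t : 𝓔)⟫_ℝ := by
  simpa using le_iSup_inner h0 (by simp) g

/-- Weak duality: for `t ∈ C` in the unit ball and `u ∈ T`, `⟪g, t⟫ ≤ ⟪g - u, t⟫ ≤ ‖g - u‖`. -/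
theorem statDim_le_expDistSq {C T : Set 𝓔} (h0 : (0 : 𝓔) ∈ C) (hT : T.Nonempty)
    (hTC : T ⊆ polarCone C) : statDim C ≤ expDistSq T := by
  refine integral_mono (integrable_sup_sq C) (integrable_infDist_sq T) fun g => ?_
  refine pow_le_pow_left₀ (iSup_inner_nonneg h0 g) ?_ 2
  have : Nonempty ↥(C ∩ Metric.closedBall (0 : 𝓔) 1) := ⟨⟨0, h0, by simp⟩⟩
  refine ciSup_le fun t => (Metric.le_infDist hT).2 fun u hu => ?_
  have h1 := hTC hu t t.2.1
  have h2 := t.2.2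
  rw [mem_closedBall_zero_iff] at h2
  have h3 := (real_inner_le_norm (g - u) t).trans (mul_le_of_le_one_right (norm_nonneg _) h2)
  rw [inner_sub_left] at h3
  rw [dist_eq_norm]
  linarith

/-- Moreau's decomposition: the residual `g - u` of the projection onto `K` lies in the polar of `K`
and is orthogonal to `u`, so it is itself a test direction for the supremum. The bound `⟪g, c⟫ ≤ M *
‖c‖` passes to limits, which is why `closure C` suffices. -/
theorem expDistSq_le_statDim {C K : Set 𝓔} (h0 : (0 : 𝓔) ∈ C)
    (hC : ∀ a : ℝ, 0 < a → ∀ c ∈ C, a • c ∈ C) (hK0 : (0 : 𝓔) ∈ K) (hKc : IsClosed K)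
    (hK : Convex ℝ K) (hKs : ∀ a : ℝ, 0 ≤ a → ∀ u ∈ K, a • u ∈ K)
    (hCK : polarCone K ⊆ closure C) : expDistSq K ≤ statDim C := by
  refine integral_mono (integrable_infDist_sq K) (integrable_sup_sq C) fun g => ?_
  refine pow_le_pow_left₀ Metric.infDist_nonneg ?_ 2
  obtain ⟨u, hu, hproj⟩ := exists_forall_inner_sub_le_zero ⟨0, hK0⟩ hKc hK g
  rw [infDist_eq_norm_sub_of_proj hu hproj]
  set M := ⨆ t : ↥(C ∩ Metric.closedBall 0 1), ⟪g, (t : 𝓔)⟫_ℝ with hM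
  have hbound : ∀ c ∈ C, ⟪g, c⟫_ℝ ≤ M * ‖c‖ := fun c hc => by
    rcases eq_or_ne c 0 with rfl | hc0
    · simp
    have hpos := norm_pos_iff.2 hc0
    have h1 := le_iSup_inner (hC ‖c‖⁻¹ (by positivity) c hc)
      (by rw [norm_smul, norm_inv, norm_norm, inv_mul_cancel₀ hpos.ne']) g
    rw [inner_smul_right, ← hM, inv_mul_le_iff₀ hpos] at h1
    linarith
  -- The test points `2u` and `0` of the cone give the two inequalities.
  have horth : ⟪g - u, u⟫_ℝ = 0 := by
    have h1 := hproj _ (hKs 2 (by norm_num) u hu)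
    have h2 := hproj _ hK0
    rw [two_smul, add_sub_cancel_right] at h1
    rw [zero_sub, inner_neg_right] at h2
    linarith
  have hmem : g - u ∈ polarCone K := fun v hv => by
    have h1 := hproj v hv
    rw [inner_sub_right, horth] at h1
    linarith
  have hcl : closure C ⊆ {c | ⟪g, c⟫_ℝ ≤ M * ‖c‖} :=
    closure_minimal hbound (isClosed_le (by fun_prop) (by fun_prop))
  have h1 : ⟪g, g - u⟫_ℝ ≤ M * ‖g - u‖ := hcl (hCK hmem)
  have h2 : ⟪g, g - u⟫_ℝ = ‖g - u‖ ^ 2 := by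
    rw [← real_inner_self_eq_norm_sq, inner_sub_left (x := g), real_inner_comm, real_inner_comm _ u,
      real_inner_comm, horth]
    simp
  rcases (norm_nonneg (g - u)).eq_or_lt with h | h
  · rw [← h]; exact iSup_inner_nonneg h0 g
  · rw [h2, sq] at h1
    exact le_of_mul_le_mul_right h1 h

/-- If the cone generated by `S`, together with the cone `N`, is closed, and `S`, `N` lie in parallel
hyperplanes, then some dilation `τ • S` approximates the whole cone on average. -/
theorem exists_expDistSq_add_smul_le {N S : Set 𝓔} (hN : ∃ D, N = polarCone D)
    (hSne : S.Nonempty) (hScomp : IsCompact S) (hSconv : Convex ℝ S)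
    (hcl : IsClosed (N + coneOf S)) {x : 𝓔} {c R : ℝ} (hc : 0 < c)
    (hNx : ∀ ν ∈ N, ⟪ν, x⟫_ℝ = 0) (hSx : ∀ s ∈ S, ⟪s, x⟫_ℝ = c) (hR : ∀ s ∈ S, ‖s‖ ≤ R) :
    ∃ τ : ℝ, 0 ≤ τ ∧ expDistSq (N + τ • S) ≤ expDistSq (N + coneOf S) + 2 * (‖x‖ / c * R) := by
  obtain ⟨D, rfl⟩ := hN
  have hR0 : 0 ≤ R := by
    obtain ⟨s, hs⟩ := hSne
    exact (norm_nonneg s).trans (hR s hs)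
  set K := polarCone D + coneOf S with hK
  choose P hPK hP using exists_forall_inner_sub_le_zero
    (Set.Nonempty.add ⟨0, zero_mem_polarCone D⟩ ⟨0, zero_mem_coneOf hSne⟩)
    hcl ((convex_polarCone D).add (convex_coneOf hSconv))
  have hdec : ∀ g, ∃ ν ∈ polarCone D, ∃ τ : ℝ, 0 ≤ τ ∧ ∃ s ∈ S, P g = ν + τ • s := fun g => by
    obtain ⟨ν, hν, y, ⟨τ, hτ, s, hs, rfl⟩, h⟩ := hPK g
    exact ⟨ν, hν, τ, hτ, s, hs, h.symm⟩
  choose ν hν τ hτ s hs hPeq using hdec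
  -- The chosen `τ g` is thus determined by `P g`, and inherits Lipschitz continuity from the
  -- projection.
  have hτeq : ∀ g, τ g = ⟪P g, x⟫_ℝ / c := fun g => by
    rw [hPeq, inner_add_left, hNx _ (hν g), real_inner_smul_left, hSx _ (hs g)]
    field_simp; ring
  have hτlip : LipschitzWith (‖x‖ / c).toNNReal τ := by
    refine LipschitzWith.of_dist_le_mul fun g g' => ?_
    rw [Real.dist_eq, hτeq, hτeq, ← sub_div, ← inner_sub_left, abs_div, abs_of_pos hc, dist_eq_norm,
      Real.coe_toNNReal _ (by positivity), div_mul_eq_mul_div]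
    gcongr
    refine (abs_real_inner_le_norm _ _).trans ?_
    rw [mul_comm]
    gcongr
    exact norm_le_of_inner_sub_nonneg
      (inner_sub_sub_nonneg_of_proj (hPK g) (hPK g') (hP g) (hP g'))
  set τ₀ := ∫ g, τ g ∂(stdGaussian 𝓔) with hτ₀
  have hτ₀nn : 0 ≤ τ₀ := integral_nonneg hτ
  refine ⟨τ₀, hτ₀nn, ?_⟩
  set T := polarCone D + τ₀ • S with hT
  choose Q hQT hQ using exists_forall_inner_sub_le_zero
    (Set.Nonempty.add ⟨0, zero_mem_polarCone D⟩ (hSne.smul_set (a := τ₀)))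
    ((isClosed_polarCone D).add_right_of_isCompact (hScomp.smul τ₀))
    ((convex_polarCone D).add (hSconv.smul τ₀))
  choose m hmS hm using fun w : 𝓔 =>
    hScomp.exists_isMaxOn hSne (f := fun s => ⟪s, w⟫_ℝ) (by fun_prop)
  replace hm : ∀ w, ∀ s ∈ S, ⟪s, w⟫_ℝ ≤ ⟪m w, w⟫_ℝ := fun w s hs => hm w hs
  set σ : 𝓔 → ℝ := fun g => ⟪m (g - Q g), g - Q g⟫_ℝ with hσ
  have hσle : ∀ g g', σ g ≤ σ g' + R * dist g g' := fun g g' => by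
    have h1 := hm (g' - Q g') _ (hmS (g - Q g))
    have h2 := real_inner_le_norm (m (g - Q g)) ((g - Q g) - (g' - Q g'))
    have h3 : ‖(g - Q g) - (g' - Q g')‖ ≤ ‖g - g'‖ := by
      rw [show (g - Q g) - (g' - Q g') = (g - g') - (Q g - Q g') by abel]
      exact norm_sub_le_of_inner_sub_nonneg
        (inner_sub_sub_nonneg_of_proj (hQT g) (hQT g') (hQ g) (hQ g'))
    have h4 := mul_le_mul (hR _ (hmS (g - Q g))) h3 (norm_nonneg _) hR0
    rw [inner_sub_right] at h2
    rw [dist_eq_norm]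
    simp only [hσ]
    linarith
  have hσlip : LipschitzWith R.toNNReal σ := LipschitzWith.of_le_add_mul' _ hσle
  have hpt : ∀ g, Metric.infDist g T ^ 2 ≤
      Metric.infDist g K ^ 2 + 2 * (τ g * σ g - τ₀ * σ g) := fun g => by
    rw [infDist_eq_norm_sub_of_proj (hQT g) (hQ g), infDist_eq_norm_sub_of_proj (hPK g) (hP g)]
    obtain ⟨ν', hν', _, ⟨s', hs', rfl⟩, hQeq⟩ := hQT g
    simp only at hQeq
    have hvar : ∀ μ ∈ polarCone D, ∀ r ∈ S,
        ⟪g - Q g, μ⟫_ℝ + τ₀ * ⟪r, g - Q g⟫_ℝ ≤ ⟪g - Q g, ν'⟫_ℝ + τ₀ * ⟪s', g - Q g⟫_ℝ :=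
      fun μ hμ r hr => by
        have h := hQ g _ (add_mem_add hμ (smul_mem_smul_set hr))
        rw [inner_sub_right, ← hQeq, inner_add_right, inner_add_right, inner_smul_right,
          inner_smul_right, hQeq, real_inner_comm r, real_inner_comm s'] at h
        linarith
    -- Optimality of `Q g` tested at cone parts `2ν'`, `0` and `ν' + ν g`: the first two force `⟪g -
    -- Q g, ν'⟫ = 0`, the third gives `⟪g - Q g, ν g⟫ ≤ 0`. Varying the `S` part shows that `s'`
    -- attains the support function, up to the factor `τ₀`.
    have a1 := hvar _ (add_mem_polarCone hν' hν') s' hs'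
    have a2 := hvar _ (zero_mem_polarCone D) s' hs'
    have a3 := hvar _ (add_mem_polarCone hν' (hν g)) s' hs'
    have a4 := hvar _ hν' _ (hmS (g - Q g))
    rw [inner_add_right] at a1 a3
    rw [inner_zero_right] at a2
    have a5 := mul_le_mul_of_nonneg_left (hm (g - Q g) s' hs') hτ₀nn
    have a6 := mul_le_mul_of_nonneg_left (hm (g - Q g) (s g) (hs g)) (hτ g)
    have hQi : ⟪g - Q g, Q g⟫_ℝ = τ₀ * σ g := by
      have : ∀ z, ⟪z, Q g⟫_ℝ = ⟪z, ν'⟫_ℝ + τ₀ * ⟪s', z⟫_ℝ := fun z => by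
        rw [← hQeq, inner_add_right, inner_smul_right, real_inner_comm s']
      rw [this]; simp only [hσ]; linarith
    have hPi : ⟪g - Q g, P g⟫_ℝ ≤ τ g * σ g := by
      rw [hPeq, inner_add_right, inner_smul_right, real_inner_comm (s g)]
      simp only [hσ]; linarith
    have h1 := norm_add_sq_real (g - Q g) (Q g - P g)
    rw [sub_add_sub_cancel, inner_sub_right] at h1
    nlinarith [sq_nonneg ‖Q g - P g‖]
  have hτ2 := memLp_two_of_lipschitzWith (μ := stdGaussian 𝓔) hτlip
  have hσ2 := memLp_two_of_lipschitzWith (μ := stdGaussian 𝓔) hσlip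
  have i1 : Integrable (fun g => τ g * σ g) (stdGaussian 𝓔) := hτ2.integrable_mul hσ2
  have i2 : Integrable (fun g => τ₀ * σ g) (stdGaussian 𝓔) :=
    (hσ2.integrable one_le_two).const_mul _
  have i3 := (i1.sub' i2).const_mul 2
  have hint := integral_mono (integrable_infDist_sq T) ((integrable_infDist_sq K).add i3) hpt
  simp only [Pi.add_apply] at hint
  rw [integral_add (integrable_infDist_sq K) i3, integral_const_mul, integral_sub i1 i2,
    integral_const_mul] at hint
  -- As `τ₀` is the mean of `τ`, the integrated error is exactly twice a covariance.
  have hcov := integral_mul_sub_le_of_lipschitzWith hτlip hσlip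
  rw [Real.coe_toNNReal _ (by positivity), Real.coe_toNNReal _ hR0, ← hτ₀] at hcov
  unfold expDistSq
  linarith

end Cones

/-! ### The normal cone of the orthant. -/

section Orthant

variable {n : ℕ}

local notation "𝓔" => EuclideanSpace ℝ (Fin n)

/-- The implication also covers a base point outside `C`: the indicator is `⊤` there and every
direction counts as a descent direction. -/
theorem convexIndicator_le_iff (C : Set 𝓔) (y x : 𝓔) :
    convexIndicator C y ≤ convexIndicator C x ↔ (x ∈ C → y ∈ C) := by
  unfold convexIndicator
  split_ifs with h1 h2 h2 <;> simp [h1, h2]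

theorem mem_descentCone_convexIndicator_iff {C : Set 𝓔} {x d : 𝓔} :
    d ∈ descentCone (convexIndicator C) x ↔ ∃ a : ℝ, 0 < a ∧ (x ∈ C → x + a • d ∈ C) := by
  simp only [descentCone, mem_ofPred_eq, convexIndicator_le_iff]

theorem inner_eq_zero_of_mem_normalCone_nonnegOrthant {x ν : 𝓔}
    (hν : ν ∈ normalCone (convexIndicator (nonnegOrthant n)) x) : ⟪ν, x⟫_ℝ = 0 := by
  have h1 := hν x (mem_descentCone_convexIndicator_iff.2
    ⟨1, one_pos, fun hx i => by simpa using hx i⟩)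
  have h2 := hν (-x) (mem_descentCone_convexIndicator_iff.2
    ⟨1, one_pos, fun _ i => by simp⟩)
  rw [inner_neg_right] at h2
  linarith

/-- The bipolar would in general be a closure; no closure is needed since the orthant is polyhedral.
At active coordinates `-eᵢ` is a normal vector, forcing `d i ≥ 0`; the finitely many other
coordinates stay positive for small steps. -/
theorem polarCone_normalCone_nonnegOrthant_subset (x : 𝓔) :
    polarCone (normalCone (convexIndicator (nonnegOrthant n)) x) ⊆
      descentCone (convexIndicator (nonnegOrthant n)) x := by
  intro d hd
  rw [mem_descentCone_convexIndicator_iff]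
  by_cases hx : x ∈ nonnegOrthant n
  swap
  · exact ⟨1, one_pos, fun h => absurd h hx⟩
  have hzero : ∀ i, x i = 0 → 0 ≤ d i := fun i hi => by
    have hmem : -EuclideanSpace.single i (1 : ℝ) ∈
        normalCone (convexIndicator (nonnegOrthant n)) x := fun d' hd' => by
      obtain ⟨a, ha, h⟩ := mem_descentCone_convexIndicator_iff.1 hd'
      have h1 := h hx i
      simp only [PiLp.add_apply, PiLp.smul_apply, smul_eq_mul, hi, zero_add] at h1
      have h2 := nonneg_of_mul_nonneg_right h1 ha
      simpa [inner_neg_left, EuclideanSpace.inner_single_left] using h2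
    simpa [inner_neg_right, EuclideanSpace.inner_single_right] using hd _ hmem
  have hsmall : ∀ i, ∀ᶠ a : ℝ in nhdsWithin 0 (Ioi 0), 0 ≤ x i + a * d i := fun i => by
    rcases (hx i).eq_or_lt with h | h
    · filter_upwards [self_mem_nhdsWithin] with a ha
      rw [← h, zero_add]
      exact mul_nonneg (le_of_lt ha) (hzero i h.symm)
    · have hc : Filter.Tendsto (fun a : ℝ => x i + a * d i) (nhdsWithin 0 (Ioi 0)) (nhds (x i)) :=
        (Continuous.tendsto' (by fun_prop) _ _ (by simp)).mono_left nhdsWithin_le_nhds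
      exact (hc.eventually (lt_mem_nhds h)).mono fun _ => le_of_lt
  obtain ⟨a, ha, hpos⟩ := ((Filter.eventually_all.2 hsmall).and self_mem_nhdsWithin).exists
  exact ⟨a, hpos, fun _ i => by simpa using ha i⟩

end Orthant

/-! ### Subgradients of norms and the polar of the restricted cone. -/

section Norms

variable {n : ℕ}

local notation "𝓔" => EuclideanSpace ℝ (Fin n)

theorem mem_subdifferential_coe_iff {p : 𝓔 → ℝ} {f : 𝓔 → EReal}
    (hf : ∀ x, f x = ((p x : ℝ) : EReal)) {z u : 𝓔} :
    u ∈ subdifferential f z ↔ ∀ t, p z + ⟪u, t⟫_ℝ ≤ p (z + t) := by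
  simp only [subdifferential, mem_ofPred_eq, hf, ← EReal.coe_add, EReal.coe_le_coe_iff]

theorem convex_subdifferential_coe {p : 𝓔 → ℝ} {f : 𝓔 → EReal}
    (hf : ∀ x, f x = ((p x : ℝ) : EReal)) (z : 𝓔) : Convex ℝ (subdifferential f z) := by
  intro u hu v hv a b ha hb hab
  rw [mem_subdifferential_coe_iff hf] at *
  intro t
  rw [inner_add_left, real_inner_smul_left, real_inner_smul_left]
  have h1 := mul_le_mul_of_nonneg_left (hu t) ha
  have h2 := mul_le_mul_of_nonneg_left (hv t) hb
  obtain rfl : b = 1 - a := by linarith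
  linarith

/-- Euler's identity for a positively homogeneous function: test the subgradient inequality at `z`
and `-z`. -/
theorem Seminorm.inner_eq_of_mem_subdifferential (p : Seminorm ℝ 𝓔) {f : 𝓔 → EReal}
    (hf : ∀ x, f x = ((p x : ℝ) : EReal)) {z u : 𝓔} (hu : u ∈ subdifferential f z) :
    ⟪u, z⟫_ℝ = p z := by
  rw [mem_subdifferential_coe_iff hf] at hu
  have h1 := hu z
  have h2 := hu (-z)
  rw [add_neg_cancel, map_zero, inner_neg_right] at h2
  linarith [map_add_le_add p z z]

theorem Seminorm.continuous_euclideanSpace (p : Seminorm ℝ 𝓔) : Continuous p :=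
  continuousOn_univ.1 (p.convexOn.continuousOn isOpen_univ)

/-- A direction that is not a strict descent direction of a norm makes a non-obtuse angle with
some subgradient. -/
theorem Seminorm.exists_mem_subdifferential_inner_nonneg (p : Seminorm ℝ 𝓔) {f : 𝓔 → EReal}
    (hf : ∀ x, f x = ((p x : ℝ) : EReal)) {x d : 𝓔} (hx : 0 < p x)
    (hd : ∀ t : ℝ, 0 ≤ t → p x ≤ p (x + t • d)) :
    ∃ s ∈ subdifferential f x, 0 ≤ ⟪s, d⟫_ℝ := by
  have hs1 : Convex ℝ {y | p y < p x} := by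
    simpa using p.convexOn.convex_lt (p x)
  have hs2 : IsOpen {y | p y < p x} :=
    isOpen_lt p.continuous_euclideanSpace continuous_const
  have ht : Convex ℝ ((fun t : ℝ => x + t • d) '' Ici 0) := by
    rintro _ ⟨t, ht, rfl⟩ _ ⟨t', ht', rfl⟩ a b ha hb hab
    refine ⟨a * t + b * t', ?_, ?_⟩
    · exact add_nonneg (mul_nonneg ha ht) (mul_nonneg hb ht')
    · obtain rfl : b = 1 - a := by linarith
      module
  -- Separate the open sublevel set from the ray. By homogeneity the functional satisfies `φ ≤ (α /
  -- p x) p` with equality at `x`, so its multiple by `p x / α` is a subgradient.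
  obtain ⟨φ, α, h1, h2⟩ := geometric_hahn_banach_open hs1 hs2 ht (by
    rw [Set.disjoint_left]
    rintro _ hy ⟨t, ht, rfl⟩
    exact absurd hy (not_lt.2 (hd t ht)))
  have hα : 0 < α := by simpa using h1 0 (by simpa using hx)
  have hφ : ∀ y, φ y * p x ≤ α * p y := fun y => by
    by_contra! hcon
    have hpos : 0 < φ y :=
      pos_of_mul_pos_left ((mul_nonneg hα.le (apply_nonneg p y)).trans_lt hcon) hx.le
    have h3 := h1 ((α / φ y) • y) (by
      change p _ < p x
      rw [map_smul_eq_mul, Real.norm_of_nonneg (by positivity), div_mul_eq_mul_div,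
        div_lt_iff₀ hpos]
      linarith)
    rw [map_smul, smul_eq_mul, div_mul_cancel₀ _ hpos.ne'] at h3
    exact lt_irrefl _ h3
  have hxα : φ x = α := by
    refine le_antisymm (le_of_mul_le_mul_right (hφ x) hx) ?_
    simpa using h2 x ⟨0, by simp, by simp⟩
  have hφd : 0 ≤ φ d := by
    have := h2 (x + d) ⟨1, by simp, by simp⟩
    rw [map_add] at this
    linarith
  have hin : ∀ y, ⟪(p x / α) • (InnerProductSpace.toDual ℝ 𝓔).symm φ, y⟫_ℝ = p x / α * φ y :=
    fun y => by rw [real_inner_smul_left, InnerProductSpace.toDual_symm_apply]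
  refine ⟨(p x / α) • (InnerProductSpace.toDual ℝ 𝓔).symm φ, ?_, ?_⟩
  · rw [mem_subdifferential_coe_iff hf]
    intro t
    have h3 := hφ (x + t)
    rw [hin]
    have h4 : p x + p x / α * φ t = φ (x + t) * p x / α := by
      rw [map_add, hxα]; field_simp
    rw [h4, div_le_iff₀ hα]
    linarith
  · rw [hin]
    positivity

theorem mem_nonnegRestrictedCone_iff {p : 𝓔 → ℝ} {f : 𝓔 → EReal}
    (hf : ∀ x, f x = ((p x : ℝ) : EReal)) {x u : 𝓔} :
    u ∈ nonnegRestrictedCone f x ↔ ∃ t : ℝ, 0 < t ∧ p (x + t • u) ≤ p x ∧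
      (x ∈ nonnegOrthant n → x + t • u ∈ nonnegOrthant n) := by
  simp only [nonnegRestrictedCone, priorRestrictedCone, priorRestrictedSet, mem_ofPred_eq,
    Fin.forall_fin_two, Matrix.cons_val_zero, Matrix.cons_val_one, hf, EReal.coe_le_coe_iff,
    convexIndicator_le_iff]

theorem Seminorm.apply_add_smul_le_of_le (p : Seminorm ℝ 𝓔) {x d : 𝓔} {a t : ℝ} (ht : 0 ≤ t)
    (hta : t ≤ a) (ha : 0 < a) (h : p (x + a • d) ≤ p x) : p (x + t • d) ≤ p x := by
  have h1 : x + t • d = (1 - t / a) • x + (t / a) • (x + a • d) := by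
    have : t = t / a * a := by field_simp
    conv_lhs => rw [this]
    module
  have h2 : t / a ≤ 1 := (div_le_one ha).2 hta
  have h3 := map_add_le_add p ((1 - t / a) • x) ((t / a) • (x + a • d))
  rw [← h1, map_smul_eq_mul, map_smul_eq_mul, Real.norm_of_nonneg (by linarith),
    Real.norm_of_nonneg (by positivity)] at h3
  have h4 := mul_le_mul_of_nonneg_left h (show 0 ≤ t / a by positivity)
  linarith

theorem add_smul_mem_nonnegOrthant_of_le {x d : 𝓔} {a t : ℝ} (hx : x ∈ nonnegOrthant n)
    (ht : 0 ≤ t) (hta : t ≤ a) (h : x + a • d ∈ nonnegOrthant n) :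
    x + t • d ∈ nonnegOrthant n := fun i => by
  have h1 := hx i
  have h2 := h i
  simp only [PiLp.add_apply, PiLp.smul_apply, smul_eq_mul] at h2 ⊢
  rcases le_total 0 (d i) with hd | hd
  · positivity
  · nlinarith

theorem Seminorm.mem_nonnegRestrictedCone_of_inner_neg (p : Seminorm ℝ 𝓔) {f : 𝓔 → EReal}
    (hf : ∀ x, f x = ((p x : ℝ) : EReal)) {x d : 𝓔} (hx : 0 < p x)
    (hd : ∀ s ∈ subdifferential f x, ⟪s, d⟫_ℝ < 0)
    (hd' : d ∈ descentCone (convexIndicator (nonnegOrthant n)) x) :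
    d ∈ nonnegRestrictedCone f x := by
  obtain ⟨a, ha, hda⟩ : ∃ a : ℝ, 0 < a ∧ p (x + a • d) ≤ p x := by
    by_contra! hcon
    obtain ⟨s, hs, hsd⟩ := p.exists_mem_subdifferential_inner_nonneg hf hx (d := d) fun t ht => by
      rcases ht.eq_or_lt with rfl | ht
      · simp
      · exact (hcon t ht).le
    exact absurd (hd s hs) (not_lt.2 hsd)
  obtain ⟨b, hb, hdb⟩ := mem_descentCone_convexIndicator_iff.1 hd'
  -- Both constraints persist for shorter steps, so the smaller step serves both.
  have hab : 0 < min a b := lt_min ha hb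
  rw [mem_nonnegRestrictedCone_iff hf]
  exact ⟨min a b, hab, p.apply_add_smul_le_of_le hab.le (min_le_left _ _) ha hda,
    fun h => add_smul_mem_nonnegOrthant_of_le h hab.le (min_le_right _ _) (hdb h)⟩

theorem normalCone_add_smul_subset_polarCone {p : 𝓔 → ℝ} {f : 𝓔 → EReal}
    (hf : ∀ x, f x = ((p x : ℝ) : EReal)) (x : 𝓔) {τ : ℝ} (hτ : 0 ≤ τ) :
    normalCone (convexIndicator (nonnegOrthant n)) x + τ • subdifferential f x ⊆
      polarCone (nonnegRestrictedCone f x) := by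
  rintro _ ⟨ν, hν, _, ⟨s, hs, rfl⟩, rfl⟩ d hd
  obtain ⟨a, ha, h1, h2⟩ := (mem_nonnegRestrictedCone_iff hf).1 hd
  have h3 := hν d (mem_descentCone_convexIndicator_iff.2 ⟨a, ha, h2⟩)
  have h4 := (mem_subdifferential_coe_iff hf).1 hs (a • d)
  rw [inner_smul_right] at h4
  have h5 : ⟪s, d⟫_ℝ ≤ 0 := nonpos_of_mul_nonpos_right (by linarith) ha
  rw [inner_add_left, real_inner_smul_left]
  exact add_nonpos h3 (mul_nonpos_of_nonneg_of_nonpos hτ h5)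

/-- Strictly separating `0` from the closed convex set `N + ∂f(x)` gives a direction `e` that is
negative on the subdifferential and nonpositive on `N`. For `w` in the polar, `w + ε • e` is then a
strict descent direction that is feasible for the orthant, and it tends to `w`. -/
theorem Seminorm.polarCone_subset_closure_nonnegRestrictedCone (p : Seminorm ℝ 𝓔) {f : 𝓔 → EReal}
    (hf : ∀ x, f x = ((p x : ℝ) : EReal)) {x : 𝓔} (hx : 0 < p x)
    (hne : (subdifferential f x).Nonempty) (hcomp : IsCompact (subdifferential f x))
    (hzero : (0 : 𝓔) ∉ normalCone (convexIndicator (nonnegOrthant n)) x + subdifferential f x) :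
    polarCone (normalCone (convexIndicator (nonnegOrthant n)) x + coneOf (subdifferential f x)) ⊆
      closure (nonnegRestrictedCone f x) := by
  set N := normalCone (convexIndicator (nonnegOrthant n)) x with hN
  have hN0 : (0 : 𝓔) ∈ N := zero_mem_polarCone _
  obtain ⟨φ, α, h1, h2⟩ := geometric_hahn_banach_closed_point
    ((convex_polarCone _).add (convex_subdifferential_coe hf x))
    ((isClosed_polarCone _).add_right_of_isCompact hcomp) hzero
  rw [map_zero] at h2
  set e := (InnerProductSpace.toDual ℝ 𝓔).symm φ with he
  have hφ : ∀ y, φ y = ⟪y, e⟫_ℝ := fun y => by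
    rw [real_inner_comm, he, InnerProductSpace.toDual_symm_apply]
  have hSe : ∀ s ∈ subdifferential f x, ⟪s, e⟫_ℝ < 0 := fun s hs => by
    have := h1 (0 + s) (add_mem_add hN0 hs)
    rw [zero_add, hφ] at this
    linarith
  have hNe : ∀ ν ∈ N, ⟪ν, e⟫_ℝ ≤ 0 := fun ν hν => by
    by_contra! hcon
    obtain ⟨s, hs⟩ := hne
    -- This multiple of `ν` makes the pairing of the sum with `e` vanish, against the strictly
    -- negative bound `α`.
    have h3 := h1 _ (add_mem_add
      (smul_mem_polarCone (a := -⟪s, e⟫_ℝ / ⟪ν, e⟫_ℝ)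
        (div_nonneg (neg_nonneg.2 (hSe s hs).le) hcon.le) hν) hs)
    rw [hφ, inner_add_left, real_inner_smul_left, div_mul_cancel₀ _ hcon.ne'] at h3
    linarith
  intro w hw
  have hNw : ∀ ν ∈ N, ⟪ν, w⟫_ℝ ≤ 0 := fun ν hν => by
    have := hw _ (add_mem_add hν (zero_mem_coneOf hne))
    rwa [add_zero, real_inner_comm] at this
  have hSw : ∀ s ∈ subdifferential f x, ⟪s, w⟫_ℝ ≤ 0 := fun s hs => by
    have := hw _ (add_mem_add hN0 (⟨1, zero_le_one, s, hs, by simp⟩ : s ∈ coneOf _))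
    rwa [zero_add, real_inner_comm] at this
  have htend : Filter.Tendsto (fun ε : ℝ => w + ε • e) (nhdsWithin 0 (Ioi 0)) (nhds w) :=
    (Continuous.tendsto' (by fun_prop) _ _ (by simp)).mono_left nhdsWithin_le_nhds
  refine mem_closure_of_tendsto htend ?_
  filter_upwards [self_mem_nhdsWithin] with ε hε
  rw [mem_Ioi] at hε
  refine p.mem_nonnegRestrictedCone_of_inner_neg hf hx (fun s hs => ?_)
    (polarCone_normalCone_nonnegOrthant_subset x fun ν hν => ?_)
  · rw [inner_add_right, inner_smul_right]
    exact add_neg_of_nonpos_of_neg (hSw s hs) (mul_neg_of_pos_of_neg hε (hSe s hs))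
  · rw [real_inner_comm, inner_add_right, inner_smul_right]
    exact add_nonpos (hNw ν hν) (mul_nonpos_of_nonneg_of_nonpos hε.le (hNe ν hν))

end Norms

/-! ### The two bounds assembled. -/

theorem mainTheorem6 {n : ℕ} (p : Seminorm ℝ (EuclideanSpace ℝ (Fin n)))
    (hp : ∀ x, p x = 0 → x = 0)
    (f₀ : EuclideanSpace ℝ (Fin n) → EReal) (hf₀ : ∀ x, f₀ x = ((p x : ℝ) : EReal))
    (xs : EuclideanSpace ℝ (Fin n))
    (N : Set (EuclideanSpace ℝ (Fin n)))
    (hN : N = normalCone (convexIndicator (nonnegOrthant n)) xs)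
    (hne : (subdifferential f₀ xs).Nonempty)
    (hcomp : IsCompact (subdifferential f₀ xs))
    (hzero : (0 : EuclideanSpace ℝ (Fin n)) ∉ subdifferential f₀ xs)
    (hri : (intrinsicInterior ℝ (descentCone f₀ xs) ∩
      intrinsicInterior ℝ (descentCone (convexIndicator (nonnegOrthant n)) xs)).Nonempty)
    (hzeroN : (0 : EuclideanSpace ℝ (Fin n)) ∉ N + subdifferential f₀ xs)
    (hclosed : IsClosed (N + coneOf (subdifferential f₀ xs))) :
    0 ≤ sInf (J₃ f₀ xs '' Ici 0) - statDim (nonnegRestrictedCone f₀ xs) ∧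
    sInf (J₃ f₀ xs '' Ici 0) - statDim (nonnegRestrictedCone f₀ xs) ≤
      2 * sSup ((fun s => ‖s‖) '' subdifferential f₀ xs) / p (‖xs‖⁻¹ • xs) := by
  subst hN
  -- At the origin `0` is a subgradient of any norm.
  have hxs : xs ≠ 0 := by
    rintro rfl
    refine hzero ((mem_subdifferential_coe_iff hf₀).2 fun t => ?_)
    simp
  have hpx : 0 < p xs := (apply_nonneg p xs).lt_of_ne' fun h => hxs (hp xs h)
  have hC0 : (0 : EuclideanSpace ℝ (Fin n)) ∈ nonnegRestrictedCone f₀ xs :=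
    (mem_nonnegRestrictedCone_iff hf₀).2 ⟨1, one_pos, by simp, by simp⟩
  have hlow : ∀ τ : ℝ, 0 ≤ τ → statDim (nonnegRestrictedCone f₀ xs) ≤ J₃ f₀ xs τ := fun τ hτ =>
    statDim_le_expDistSq hC0 (Set.Nonempty.add ⟨0, zero_mem_polarCone _⟩ hne.smul_set)
      (normalCone_add_smul_subset_polarCone hf₀ xs hτ)
  constructor
  · refine sub_nonneg.2 (le_csInf (nonempty_Ici.image _) ?_)
    rintro _ ⟨τ, hτ, rfl⟩
    exact hlow τ hτ
  have hR : ∀ s ∈ subdifferential f₀ xs,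
      ‖s‖ ≤ sSup ((fun s => ‖s‖) '' subdifferential f₀ xs) := fun s hs =>
    le_csSup (hcomp.bddAbove_image (by fun_prop)) (mem_image_of_mem _ hs)
  obtain ⟨τ, hτ, hle⟩ := exists_expDistSq_add_smul_le
    (N := normalCone (convexIndicator (nonnegOrthant n)) xs) ⟨_, rfl⟩ hne hcomp
    (convex_subdifferential_coe hf₀ xs) hclosed hpx
    (fun ν hν => inner_eq_zero_of_mem_normalCone_nonnegOrthant hν)
    (fun s hs => p.inner_eq_of_mem_subdifferential hf₀ hs) hR
  have hK := expDistSq_le_statDim (C := nonnegRestrictedCone f₀ xs)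
    (K := normalCone (convexIndicator (nonnegOrthant n)) xs + coneOf (subdifferential f₀ xs)) hC0
    (fun a ha c hc => by
      obtain ⟨t, ht, h⟩ := (mem_nonnegRestrictedCone_iff hf₀).1 hc
      refine (mem_nonnegRestrictedCone_iff hf₀).2 ⟨t / a, by positivity, ?_⟩
      rwa [smul_smul, div_mul_cancel₀ _ ha.ne'])
    ⟨0, zero_mem_polarCone _, 0, zero_mem_coneOf hne, add_zero 0⟩ hclosed
    ((convex_polarCone _).add (convex_coneOf (convex_subdifferential_coe hf₀ xs)))
    (by
      rintro a ha _ ⟨ν, hν, y, hy, rfl⟩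
      exact ⟨a • ν, smul_mem_polarCone ha hν, a • y, smul_mem_coneOf ha hy, (smul_add a ν y).symm⟩)
    (p.polarCone_subset_closure_nonnegRestrictedCone hf₀ hpx hne hcomp hzeroN)
  have hinf : sInf (J₃ f₀ xs '' Ici 0) ≤ J₃ f₀ xs τ := by
    refine csInf_le ⟨statDim (nonnegRestrictedCone f₀ xs), ?_⟩ (mem_image_of_mem _ hτ)
    rintro _ ⟨τ', hτ', rfl⟩
    exact hlow τ' hτ'
  have hrhs : 2 * sSup ((fun s => ‖s‖) '' subdifferential f₀ xs) / p (‖xs‖⁻¹ • xs) =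
      2 * (‖xs‖ / p xs * sSup ((fun s => ‖s‖) '' subdifferential f₀ xs)) := by
    have : 0 < ‖xs‖ := norm_pos_iff.2 hxs
    rw [map_smul_eq_mul, norm_inv, norm_norm]
    field_simp
  rw [hrhs]
  change J₃ f₀ xs τ ≤ _ at hle
  linarith
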